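/- Conventions. All rings are commutative with unit, and a property $\mathfrak P$ of modules assigns to each commutative ring $R$ a class $\mathfrak P_R$ of $R$-modules. Let $\mathcal R$ be a class of commutative rings. We say that $\mathfrak P$ is an ascent–descent property (AD-property) in $\mathcal R$ if for all $R, S \in \mathcal R$, each flat ring homomorphism $\varphi : R \to S$ and each $R$-module $M$: (1) if $M \in \mathfrak P_R$, then $M \otimes_R S \in \mathfrak P_S$; (2) if $\varphi$ is faithfully flat and $M \otimes_R S \in \mathfrak P_S$, then $M \in \mathfrak P_R$. For a class $\mathcal C$ of $R$-modules, an $R$-module $M$ is $\mathcal C$-filtered if there are an ordinal $\sigma$ and an increasing chain $(M_\alpha \mid \alpha \le \sigma)$ of submodules of $M$ with $M_0 = 0$, $M_\sigma = M$, $M_\alpha = \bigcup_{\beta<\alpha} M_\beta$ for each limit ordinal $\alpha \le \sigma$, and $M_{\alpha+1}/M_\alpha$ isomorphic to an element of $\mathcal C$ for each $\alpha < \sigma$. The class $\mathcal C$ is closed under transfinite extensions if it contains every $\mathcal C$-filtered module. A submodule $N \subseteq M$ is pure if $X \otimes_R N \to X \otimes_R M$ is injective for every $R$-module $X$. A module is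 $\le\kappa$-presented if it has a presentation with at most $\kappa$ generators and at most $\kappa$ relations. Theorem 4.2. Let $\mathcal R$ be a class of commutative rings and let $\mathfrak P$ be an AD-property in $\mathcal R$. Assume that for each $R \in \mathcal R$ the class $\mathfrak P_R$ contains $R$ and is closed under pure submodules and under transfinite extensions. Let $\kappa$ be an infinite cardinal such that for each $R \in \mathcal R$, each $M \in \mathfrak P_R$ and each subset $A \subseteq M$ of cardinality $\le \kappa$, there is a $\le\kappa$-presented pure submodule $N \subseteq M$ containing $A$. For each $R$, let $\mathfrak P_R(\kappa)$ be the class of all $R$-modules that are filtered by the class of all $\le\kappa$-presented modules from $\mathfrak P_R$. Then the property $\mathfrak R$ defined by $\mathfrak R_R = \mathfrak P_R(\kappa)$ is an AD-property in $\mathcal R$. -/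

import Mathlib

open scoped TensorProduct

universe u

namespace ADProp

/-- A class of modules over the commutative ring `R`. -/
abbrev ModuleClass (R : Type u) [CommRing R] : Type (u + 1) :=
  ∀ (M : Type u) [AddCommGroup M] [Module R M], Prop

/-- A class of commutative rings. -/
abbrev RingClass : Type (u + 1) :=
  ∀ (R : Type u) [CommRing R], Prop

/-- A property `P` of modules over commutative rings: `P R` is the class of all
`R`-modules that satisfy it. -/
abbrev ModuleProperty : Type (u + 1) :=
  ∀ (R : Type u) [CommRing R], ModuleClass R

section OneRing

variable {R : Type u} [CommRing R]

/-- `N` is a pure submodule of `M`: for every `R`-module `X`, the map `X ⊗ N → X ⊗ M` induced by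
the inclusion is injective. -/
def IsPureSubmodule {M : Type u} [AddCommGroup M] [Module R M] (N : Submodule R M) : Prop :=
  ∀ (X : Type u) [AddCommGroup X] [Module R X], Function.Injective (N.subtype.lTensor X)

variable (R) in
/-- `M` is `≤ κ`-presented: it has a presentation by at most `κ` generators and at most `κ`
relations. -/
def IsLEPresented (κ : Cardinal.{u}) (M : Type u) [AddCommGroup M] [Module R M] : Prop :=
  ∃ p : Module.Presentation.{u, u} R M, Cardinal.mk p.G ≤ κ ∧ Cardinal.mk p.R ≤ κ

/-- `(F α ∣ α ≤ σ)` is a `C`-filtration of `M`: an increasing continuous chain of submodules from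
`0` to `M` whose successive factors are isomorphic to members of `C`. The values of `F` beyond `σ`
are irrelevant. -/
structure IsFiltration (C : ModuleClass R) (M : Type u) [AddCommGroup M] [Module R M]
    (σ : Ordinal.{u}) (F : Ordinal.{u} → Submodule R M) : Prop where
  zero : F 0 = ⊥
  top : F σ = ⊤
  mono : ∀ α β : Ordinal.{u}, α ≤ β → β ≤ σ → F α ≤ F β
  limit : ∀ α : Ordinal.{u}, α ≤ σ → Order.IsSuccLimit α →
    (F α : Set M) = ⋃ β : Set.Iio α, (F β : Set M)
  factor : ∀ α : Ordinal.{u}, α < σ →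
    ∃ (N : Type u) (_ : AddCommGroup N) (_ : Module R N), C N ∧
      Nonempty ((F (Order.succ α) ⧸ (F α).submoduleOf (F (Order.succ α))) ≃ₗ[R] N)

/-- The class of all `C`-filtered modules. -/
def Filtered (C : ModuleClass R) : ModuleClass R := fun M _ _ =>
  ∃ (σ : Ordinal.{u}) (F : Ordinal.{u} → Submodule R M), IsFiltration C M σ F

/-- The class `C` contains every `C`-filtered module. -/
def ClosedUnderTransfiniteExtensions (C : ModuleClass R) : Prop :=
  ∀ (M : Type u) [AddCommGroup M] [Module R M], Filtered C M → C M

/-- The class `C` contains every pure submodule of each of its members. -/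
def ClosedUnderPureSubmodules (C : ModuleClass R) : Prop :=
  ∀ (M : Type u) [AddCommGroup M] [Module R M], C M →
    ∀ N : Submodule R M, IsPureSubmodule N → C N

/-- The class of all `≤ κ`-presented members of `C`. -/
def LEPresentedIn (C : ModuleClass R) (κ : Cardinal.{u}) : ModuleClass R := fun M _ _ =>
  C M ∧ IsLEPresented R κ M

end OneRing

/-- `P` ascends along flat homomorphisms between rings in `𝓡`. A homomorphism of commutative rings
`R → S` is given as an `R`-algebra structure on `S`. -/
def Ascends (𝓡 : RingClass.{u}) (P : ModuleProperty.{u}) : Prop :=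
  ∀ (R S : Type u) [CommRing R] [CommRing S] [Algebra R S], 𝓡 R → 𝓡 S → Module.Flat R S →
    ∀ (M : Type u) [AddCommGroup M] [Module R M], P R M → P S (S ⊗[R] M)

/-- `P` descends along faithfully flat homomorphisms between rings in `𝓡`. -/
def Descends (𝓡 : RingClass.{u}) (P : ModuleProperty.{u}) : Prop :=
  ∀ (R S : Type u) [CommRing R] [CommRing S] [Algebra R S], 𝓡 R → 𝓡 S →
    Module.FaithfullyFlat R S →
    ∀ (M : Type u) [AddCommGroup M] [Module R M], P S (S ⊗[R] M) → P R M

/-- `P` is an ascent-descent property in `𝓡`. -/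
def IsADProperty (𝓡 : RingClass.{u}) (P : ModuleProperty.{u}) : Prop :=
  Ascends 𝓡 P ∧ Descends 𝓡 P

/-- The `κ`-restricted property `R ↦ P_R(κ)`: being filtered by `≤ κ`-presented members
of `P_R`. -/
def restrict (P : ModuleProperty.{u}) (κ : Cardinal.{u}) : ModuleProperty.{u} := fun R _ =>
  Filtered (LEPresentedIn (P R) κ)

end ADProp

/-! Ascent is formal: a flat base change of a filtration is a filtration, its factors are the
base-changed factors, and `≤ κ`-presentations survive base change.

Descent is the real work. A filtration of `S ⊗ M` need not consist of submodules coming from `M`, so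
it is replaced by a much larger supply of submodules, in the spirit of Hill's lemma. Choose
generators of `S ⊗ M` stratified by the levels of the filtration, at most `κ` on each. A relation at
level `i` expresses its leading part through finitely many generators of lower level, so `i` depends
on at most `κ` earlier levels. Call a set of levels closed if it contains all dependencies of its
members. For closed `T ⊆ V`, the quotient `sub V / sub T` is presented using the levels in `V \ T`
alone (`IsClosed.exists_add_of_mem_sub`). Hence it is `≤ κ`-presented when `V \ T` has at most `κ`
elements, and it is filtered by the original factors, so it lies in `P S`.

Now consider the submodules `N` of `M` whose base change is `sub T` for a closed `T`. They are
stable under sums, and a back-and-forth argument enlarges any proper one by at most `κ` generators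
while adding at most `κ` levels (`exists_closed_baseChange_span`). The base change of the new factor
is one of the quotients above, so faithful flatness makes the factor a `≤ κ`-presented member of `P
R`. Transfinite iteration filters `M`. -/

namespace ADProp

/-! ### Modules with at most `κ` generators and relations -/

section Generation

variable {R : Type u} [CommRing R] {M N : Type u} [AddCommGroup M] [Module R M]
  [AddCommGroup N] [Module R N] {κ : Cardinal.{u}}

/-- The submodule `N` is generated by at most `κ` elements. -/
def IsLEGenerated (κ : Cardinal.{u}) (N : Submodule R M) : Prop :=
  ∃ s : Set M, Cardinal.mk s ≤ κ ∧ Submodule.span R s = N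

lemma IsLEGenerated.map {K : Submodule R M} (h : IsLEGenerated κ K) (f : M →ₗ[R] N) :
    IsLEGenerated κ (K.map f) := by
  obtain ⟨s, hs, rfl⟩ := h
  exact ⟨f '' s, Cardinal.mk_image_le.trans hs, (Submodule.map_span f s).symm⟩

lemma mk_biUnion_le_of_le {ι X : Type u} (hκ : Cardinal.aleph0 ≤ κ) (s : Set ι)
    (hs : Cardinal.mk s ≤ κ) (A : ι → Set X) (hA : ∀ i ∈ s, Cardinal.mk (A i) ≤ κ) :
    Cardinal.mk (⋃ i ∈ s, A i : Set X) ≤ κ := by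
  refine (Cardinal.mk_biUnion_le A s).trans ?_
  refine (mul_le_mul' hs (ciSup_le' fun i : s => hA i.1 i.2)).trans ?_
  rw [Cardinal.mul_eq_self hκ]

lemma mk_iUnion_nat_le_of_le {X : Type u} (hκ : Cardinal.aleph0 ≤ κ) (A : ℕ → Set X)
    (hA : ∀ i, Cardinal.mk (A i) ≤ κ) : Cardinal.mk (⋃ i, A i : Set X) ≤ κ := by
  have := Cardinal.mk_iUnion_le_lift A
  simp only [Cardinal.lift_id', Cardinal.mk_nat, Cardinal.lift_aleph0] at this
  refine this.trans ((mul_le_mul' hκ (ciSup_le' hA)).trans ?_)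
  rw [Cardinal.mul_eq_self hκ]

/-- If every point has at most `κ` successors, then every point lies in a set of cardinality
at most `κ` that is closed under successors. -/
lemma exists_closed_of_mk_le {X : Type u} (hκ : Cardinal.aleph0 ≤ κ) (c : X → Set X)
    (hc : ∀ x, Cardinal.mk (c x) ≤ κ) (x : X) :
    ∃ Y : Set X, x ∈ Y ∧ Cardinal.mk Y ≤ κ ∧ ∀ y ∈ Y, c y ⊆ Y := by
  let A : ℕ → Set X := fun n => Nat.rec {x} (fun _ B => ⋃ y ∈ B, c y) n
  refine ⟨⋃ n, A n, Set.mem_iUnion.2 ⟨0, rfl⟩, ?_, ?_⟩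
  · refine mk_iUnion_nat_le_of_le hκ A fun n => ?_
    induction n with
    | zero =>
      change Cardinal.mk ({x} : Set X) ≤ κ
      rw [Cardinal.mk_singleton]
      exact Cardinal.one_le_aleph0.trans hκ
    | succ n ih => exact mk_biUnion_le_of_le hκ (A n) ih c fun y _ => hc y
  · intro y hy z hz
    obtain ⟨n, hn⟩ := Set.mem_iUnion.1 hy
    exact Set.mem_iUnion.2 ⟨n + 1, Set.mem_biUnion hn hz⟩

lemma exists_subset_of_subset_span (hκ : Cardinal.aleph0 ≤ κ) {X : Type u} (v : X → M) (A : Set X)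
    {Z : Set M} (hZ : Cardinal.mk Z ≤ κ) (hZA : Z ⊆ Submodule.span R (v '' A)) :
    ∃ B ⊆ A, Cardinal.mk B ≤ κ ∧ Z ⊆ Submodule.span R (v '' B) := by
  have h : ∀ z ∈ Z, ∃ B : Set X, B ⊆ A ∧ B.Finite ∧ z ∈ Submodule.span R (v '' B) := by
    intro z hz
    obtain ⟨T, hT, hzT⟩ := Submodule.mem_span_finite_of_mem_span (hZA hz)
    obtain ⟨B, hBA, hB, hBT⟩ := (Set.exists_subset_image_finite_and (f := v) (s := A)
      (p := fun t => t = T)).1 ⟨T, hT, T.finite_toSet, rfl⟩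
    exact ⟨B, hBA, hB, by rwa [hBT]⟩
  choose! B hBA hBf hB using h
  refine ⟨⋃ z ∈ Z, B z, Set.iUnion₂_subset hBA, mk_biUnion_le_of_le hκ Z hZ B fun z hz => ?_, ?_⟩
  · exact (Cardinal.lt_aleph0_iff_set_finite.2 (hBf z hz)).le.trans hκ
  · intro z hz
    exact Submodule.span_mono (Set.image_mono (Set.subset_biUnion_of_mem hz)) (hB z hz)

lemma exists_ker_eq_span_of_isLEPresented (h : IsLEPresented R κ M) :
    ∃ (G : Type u) (f : (G →₀ R) →ₗ[R] M), Cardinal.mk G ≤ κ ∧ Function.Surjective f ∧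
      IsLEGenerated κ (LinearMap.ker f) := by
  obtain ⟨p, hG, hR⟩ := h
  exact ⟨p.G, p.π, hG, p.surjective_π, Set.range p.relation, Cardinal.mk_range_le.trans hR,
    p.ker_π.symm⟩

lemma isLEPresented_of_surjective {ι F : Type u} [AddCommGroup F] [Module R F]
    (b : Module.Basis ι R F) (hι : Cardinal.mk ι ≤ κ) (f : F →ₗ[R] M)
    (hf : Function.Surjective f) (hker : IsLEGenerated κ (LinearMap.ker f)) :
    IsLEPresented R κ M := by
  obtain ⟨s, hs, hsf⟩ := hker
  let r : Module.Relations R := ⟨ι, s, fun x => b.repr x.1⟩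
  let g : (ι →₀ R) →ₗ[R] M := f ∘ₗ b.repr.symm.toLinearMap
  have hspan : LinearMap.ker g = Submodule.span R (Set.range r.relation) := by
    have : Set.range r.relation = b.repr.toLinearMap '' s := by
      ext x
      simp [r]
    rw [this, ← Submodule.map_span, hsf, LinearMap.ker_comp, Submodule.map_equiv_eq_comap_symm]
  let sol : r.Solution M := Module.Relations.Solution.ofπ g fun x => by
    have : r.relation x ∈ LinearMap.ker g := hspan ▸ Submodule.subset_span ⟨x, rfl⟩
    exact this
  have hsol : sol.π = g := Module.Relations.Solution.ofπ_π _ _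
  have hp : sol.IsPresentation := by
    rw [Module.Relations.Solution.isPresentation_iff,
      ← Module.Relations.Solution.surjective_π_iff_span_eq_top, hsol]
    exact ⟨hf.comp b.repr.symm.surjective, hspan⟩
  exact ⟨Module.Presentation.ofIsPresentation hp, hι, hs⟩

/-- A Schanuel-type argument: lift a small presentation `p` of `N` along `q`. The kernel is
generated by the lifted relations together with the differences between the generators of `M` and
lifts of their images. -/
lemma isLEGenerated_ker_of_isLEPresented (hκ : Cardinal.aleph0 ≤ κ) (h : IsLEPresented R κ N)
    (hM : IsLEGenerated κ (⊤ : Submodule R M)) (q : M →ₗ[R] N) (hq : Function.Surjective q) :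
    IsLEGenerated κ (LinearMap.ker q) := by
  obtain ⟨G, p, hG, hp, r, hr, hrp⟩ := exists_ker_eq_span_of_isLEPresented h
  obtain ⟨s, hs, hsM⟩ := hM
  obtain ⟨l, hl⟩ := Module.projective_lifting_property q p hq
  have hl' (x) : q (l x) = p x := LinearMap.congr_fun hl x
  choose t ht using hp
  have hrl : ∀ x ∈ LinearMap.ker p, l x ∈ Submodule.span R (l '' r) := fun x hx => by
    rw [← Submodule.map_span, hrp]
    exact Submodule.mem_map_of_mem hx
  refine ⟨(fun x => x - l (t (q x))) '' s ∪ l '' r, ?_, le_antisymm ?_ ?_⟩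
  · refine (Cardinal.mk_union_le _ _).trans
      ((add_le_add (Cardinal.mk_image_le.trans hs) (Cardinal.mk_image_le.trans hr)).trans ?_)
    rw [Cardinal.add_eq_self hκ]
  · rw [Submodule.span_le]
    rintro _ (⟨x, -, rfl⟩ | ⟨x, hx, rfl⟩)
    · simp [hl', ht]
    · have : x ∈ LinearMap.ker p := hrp ▸ Submodule.subset_span hx
      simpa [hl'] using this
  · set W := Submodule.span R ((fun x => x - l (t (q x))) '' s ∪ l '' r) with hW
    have key : ∀ x : M, ∃ y : G →₀ R, q x = p y ∧ x - l y ∈ W := by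
      intro x
      have hx : x ∈ Submodule.span R s := hsM ▸ Submodule.mem_top
      induction hx using Submodule.span_induction with
      | mem x hx => exact ⟨t (q x), (ht _).symm, Submodule.subset_span (.inl ⟨x, hx, rfl⟩)⟩
      | zero => exact ⟨0, by simp, by simp⟩
      | add x y _ _ hx hy =>
        obtain ⟨a, ha, ha'⟩ := hx
        obtain ⟨b, hb, hb'⟩ := hy
        refine ⟨a + b, by simp [ha, hb], ?_⟩
        have := W.add_mem ha' hb'
        rwa [sub_add_sub_comm, ← map_add] at this
      | smul c x _ hx =>
        obtain ⟨a, ha, ha'⟩ := hx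
        refine ⟨c • a, by simp [ha], ?_⟩
        have := W.smul_mem c ha'
        rwa [smul_sub, ← map_smul] at this
    intro x hx
    obtain ⟨y, hy, hxy⟩ := key x
    have hyp : y ∈ LinearMap.ker p := by rw [LinearMap.mem_ker, ← hy, LinearMap.mem_ker.1 hx]
    have := W.add_mem hxy (Submodule.span_mono Set.subset_union_right (hrl y hyp))
    rwa [sub_add_cancel] at this

lemma nonempty_linearEquiv_of_ker_eq {L : Type u} [AddCommGroup L] [Module R L] (f : L →ₗ[R] M)
    (g : L →ₗ[R] N) (hf : Function.Surjective f) (hg : Function.Surjective g)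
    (h : LinearMap.ker f = LinearMap.ker g) : Nonempty (M ≃ₗ[R] N) :=
  ⟨(f.quotKerEquivOfSurjective hf).symm ≪≫ₗ Submodule.quotEquivOfEq _ _ h ≪≫ₗ
    g.quotKerEquivOfSurjective hg⟩

lemma IsLEPresented.of_linearEquiv (h : IsLEPresented R κ M) (e : M ≃ₗ[R] N) :
    IsLEPresented R κ N := by
  obtain ⟨p, hG, hR⟩ := h
  exact ⟨p.ofLinearEquiv e, hG, hR⟩

end Generation

/-! ### Building filtrations by transfinite iteration -/

section Filtrations

variable {R : Type u} [CommRing R] {Q : Type u} [AddCommGroup Q] [Module R Q]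

/-- A module is filtered as soon as every proper member of a family of submodules closed under
suprema can be enlarged within the family by a factor from `C`. -/
lemma filtered_of_exists_lt (C : ModuleClass R) {X : Type u} [CompleteLattice X]
    (H : X → Submodule R Q) (hHmono : Monotone H)
    -- The suprema needed are indexed by initial segments of `Ordinal.{u}`, which live in `Type (u +
    -- 1)`.
    (hH : ∀ {ι : Type (u + 1)} (x : ι → X), H (⨆ i, x i) = ⨆ i, H (x i))
    (𝒢 : Set X) (h𝒢 : ∀ s ⊆ 𝒢, sSup s ∈ 𝒢)
    (hstep : ∀ x ∈ 𝒢, H x ≠ ⊤ → ∃ y ∈ 𝒢, x < y ∧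
      ∃ (N : Type u) (_ : AddCommGroup N) (_ : Module R N), C N ∧
        Nonempty ((H y ⧸ (H x).submoduleOf (H y)) ≃ₗ[R] N)) :
    Filtered C Q := by
  classical
  choose! nx hnx𝒢 hnx hnxC using hstep
  let next : X → X := fun x => if H x = ⊤ then x else nx x
  have le_next : ∀ x ∈ 𝒢, x ≤ next x := fun x hx => by
    by_cases h : H x = ⊤
    · simp [next, h]
    · simpa [next, h] using (hnx x hx h).le
  have next_mem : ∀ x ∈ 𝒢, next x ∈ 𝒢 := fun x hx => by
    by_cases h : H x = ⊤
    · simpa [next, h] using hx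
    · simpa [next, h] using hnx𝒢 x hx h
  -- One formula covers zero, successors and limits; the usual case equations follow from
  -- monotonicity.
  let x : Ordinal.{u} → X := WellFoundedLT.fix fun a ih => ⨆ b : Set.Iio a, next (ih b.1 b.2)
  have hx (a) : x a = ⨆ b : Set.Iio a, next (x b) := WellFoundedLT.fix_eq _ _
  have hmem (a) : x a ∈ 𝒢 := by
    induction a using WellFoundedLT.induction with
    | ind a ih =>
      rw [hx]
      refine h𝒢 _ ?_
      rintro _ ⟨b, rfl⟩
      exact next_mem _ (ih b.1 b.2)
  have next_le {a b} (h : a < b) : next (x a) ≤ x b := by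
    rw [hx b]
    exact le_iSup (fun b : Set.Iio b => next (x b)) ⟨a, h⟩
  have hmono : Monotone x := by
    intro a b h
    rcases h.eq_or_lt with rfl | h
    · rfl
    · exact (le_next _ (hmem a)).trans (next_le h)
  have hsucc (a) : x (Order.succ a) = next (x a) := by
    refine le_antisymm ?_ (next_le (Order.lt_succ a))
    rw [hx]
    refine iSup_le fun b => ?_
    rcases (Order.lt_succ_iff.1 (show b.1 < Order.succ a from b.2)).eq_or_lt with h | h
    · rw [h]
    · exact (next_le h).trans (le_next _ (hmem a))
  have hlim (a) (ha : Order.IsSuccLimit a) : x a = ⨆ b : Set.Iio a, x b := by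
    refine le_antisymm ?_ (iSup_le fun b => hmono b.2.le)
    rw [hx]
    refine iSup_le fun b => ?_
    rw [← hsucc]
    exact le_iSup (fun b : Set.Iio a => x b) ⟨_, ha.succ_lt b.2⟩
  -- Otherwise the chain never stops growing and embeds all ordinals of universe `u` into a type of
  -- that universe.
  have hex : ∃ a, H (x a) = ⊤ := by
    by_contra! hne
    refine not_injective_of_ordinal x (StrictMono.injective ?_)
    intro a b h
    refine lt_of_lt_of_le ?_ (next_le h)
    simpa [next, hne a] using hnx _ (hmem a) (hne a)
  obtain ⟨σ, hσ, hmin⟩ := WellFounded.has_min (wellFounded_lt (α := Ordinal.{u}))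
    {a | H (x a) = ⊤} hex
  refine ⟨σ, fun a => H (x a), ?_, hσ, fun a b h _ => hHmono (hmono h), ?_, ?_⟩
  · rw [hx, hH]
    refine eq_bot_iff.2 (iSup_le fun b => ?_)
    exact absurd b.2 (not_lt_bot (α := Ordinal.{u}))
  · intro a _ ha
    have hne : Nonempty (Set.Iio a) := ⟨⟨0, ha.bot_lt⟩⟩
    rw [hlim a ha, hH, Submodule.coe_iSup_of_directed]
    exact Monotone.directed_le (f := fun b : Set.Iio a => H (x b)) fun b c h => hHmono (hmono h)
  · intro a ha
    have hne : H (x a) ≠ ⊤ := fun h => hmin a h ha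
    obtain ⟨N, i, j, hN, e⟩ := hnxC _ (hmem a) hne
    refine ⟨N, i, j, hN, ?_⟩
    rwa [hsucc, show next (x a) = nx (x a) from if_neg hne]

end Filtrations

/-! ### Closed sets of levels and the relations they carry -/

section Hill

variable {R : Type u} [CommRing R]

/-- A presentation of `M` whose generators and relations are stratified by a well-ordered set, with
at most `κ` of each on every level, such that every level contributes a factor from `C`. -/
structure HillSystem (C : ModuleClass R) (κ : Cardinal.{u}) (M : Type u) [AddCommGroup M]
    [Module R M] where
  /-- the levels -/
  I : Type u
  /-- the generators -/
  G : Type u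
  [linearOrder : LinearOrder I]
  [wellFoundedLT : WellFoundedLT I]
  /-- the level of a generator -/
  rank : G → I
  /-- the presentation map -/
  π : (G →₀ R) →ₗ[R] M
  /-- the leading parts of the relations at each level -/
  rel : I → Set (G →₀ R)
  mk_gen (i) : Cardinal.mk (rank ⁻¹' {i}) ≤ κ
  mk_rel (i) : Cardinal.mk (rel i) ≤ κ
  surjective : Function.Surjective π
  mem_span_rel (i x) : x ∈ Submodule.span R (rel i) ↔
    x ∈ Finsupp.supported R R (rank ⁻¹' {i}) ∧
      π x ∈ (Finsupp.supported R R (rank ⁻¹' Set.Iio i)).map π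
  -- Quantifying over every `Q` presented by the generators and relations of level `i` builds
  -- invariance under isomorphism into the structure.
  factor (i) (Q : Type u) [AddCommGroup Q] [Module R Q] (f : (G →₀ R) →ₗ[R] Q)
    (hf : (Finsupp.supported R R (rank ⁻¹' {i})).map f = ⊤)
    (hker : ∀ x ∈ Finsupp.supported R R (rank ⁻¹' {i}),
      f x = 0 ↔ x ∈ Submodule.span R (rel i)) : C Q

namespace HillSystem

attribute [instance] linearOrder wellFoundedLT

variable {C : ModuleClass R} {κ : Cardinal.{u}} {M : Type u} [AddCommGroup M] [Module R M]
  (D : HillSystem C κ M)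

/-- The free module on the generators with level in `T`. -/
noncomputable def free (T : Set D.I) : Submodule R (D.G →₀ R) := Finsupp.supported R R (D.rank ⁻¹' T)

/-- The submodule generated by the generators with level in `T`. -/
noncomputable def sub (T : Set D.I) : Submodule R M := (D.free T).map D.π

lemma free_mono {T U : Set D.I} (h : T ⊆ U) : D.free T ≤ D.free U :=
  Finsupp.supported_mono (Set.preimage_mono h)

lemma sub_mono {T U : Set D.I} (h : T ⊆ U) : D.sub T ≤ D.sub U := Submodule.map_mono (D.free_mono h)

lemma free_union (T U : Set D.I) : D.free (T ∪ U) = D.free T ⊔ D.free U :=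
  Finsupp.supported_union _ _

lemma free_iUnion {ι : Type*} (T : ι → Set D.I) : D.free (⋃ i, T i) = ⨆ i, D.free (T i) := by
  rw [free, Set.preimage_iUnion]
  exact Finsupp.supported_iUnion _

lemma free_inter (T U : Set D.I) : D.free (T ∩ U) = D.free T ⊓ D.free U :=
  Finsupp.supported_inter _ _

lemma free_empty : D.free ∅ = ⊥ := Finsupp.supported_empty

lemma free_univ : D.free Set.univ = ⊤ := Finsupp.supported_univ

lemma sub_univ : D.sub Set.univ = ⊤ := by
  rw [sub, free_univ, Submodule.map_top, LinearMap.range_eq_top.2 D.surjective]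

lemma sub_iUnion {ι : Type*} (T : ι → Set D.I) : D.sub (⋃ i, T i) = ⨆ i, D.sub (T i) := by
  rw [sub, free_iUnion, Submodule.map_iSup]; rfl

lemma sub_eq_span (T : Set D.I) :
    D.sub T = Submodule.span R ((fun g => D.π (Finsupp.single g 1)) '' (D.rank ⁻¹' T)) := by
  rw [sub, free, Finsupp.supported_eq_span_single, Submodule.map_span, Set.image_image]

lemma mk_rank_preimage_le (hκ : Cardinal.aleph0 ≤ κ) {T : Set D.I} (hT : Cardinal.mk T ≤ κ) :
    Cardinal.mk (D.rank ⁻¹' T) ≤ κ := by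
  have : D.rank ⁻¹' T = ⋃ i ∈ T, D.rank ⁻¹' {i} := by ext; simp
  rw [this]
  exact mk_biUnion_le_of_le hκ T hT _ fun i _ => D.mk_gen i

lemma exists_mem_free_Iic {T : Set D.I} {x : D.G →₀ R} (hx : x ∈ D.free T) (h0 : x ≠ 0) :
    ∃ j ∈ T, x ∈ D.free (T ∩ Set.Iic j) := by
  obtain ⟨g, hg, hmax⟩ := Finset.exists_max_image x.support D.rank
    (Finsupp.support_nonempty_iff.2 h0)
  exact ⟨D.rank g, hx hg, fun y hy => ⟨hx hy, hmax y hy⟩⟩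

/-- A combination of generators of lower level with the same image in `M` as `r`. -/
noncomputable def corr (i : D.I) (r : D.G →₀ R) : D.G →₀ R :=
  Classical.epsilon fun c => c ∈ D.free (Set.Iio i) ∧ D.π c = D.π r

lemma corr_spec {i : D.I} {r : D.G →₀ R} (hr : r ∈ D.rel i) :
    D.corr i r ∈ D.free (Set.Iio i) ∧ D.π (D.corr i r) = D.π r := by
  have := ((D.mem_span_rel i r).1 (Submodule.subset_span hr)).2
  obtain ⟨c, hc, hcr⟩ := this
  exact Classical.epsilon_spec (p := fun c => c ∈ D.free (Set.Iio i) ∧ D.π c = D.π r) ⟨c, hc, hcr⟩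

/-- The levels on which the relations at level `i` depend. -/
def deps (i : D.I) : Set D.I := D.rank '' ⋃ r ∈ D.rel i, ((D.corr i r).support : Set D.G)

lemma mk_deps_le (hκ : Cardinal.aleph0 ≤ κ) (i : D.I) : Cardinal.mk (D.deps i) ≤ κ :=
  Cardinal.mk_image_le.trans <| mk_biUnion_le_of_le hκ _ (D.mk_rel i) _ fun _ _ =>
    (Cardinal.lt_aleph0_of_finite _).le.trans hκ

lemma deps_subset_Iio (i : D.I) : D.deps i ⊆ Set.Iio i := by
  rintro _ ⟨g, hg, rfl⟩
  obtain ⟨r, hr, hg⟩ := Set.mem_iUnion₂.1 hg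
  exact (D.corr_spec hr).1 hg

/-- A set of levels that contains all levels on which its members depend. -/
def IsClosed (T : Set D.I) : Prop := ∀ i ∈ T, D.deps i ⊆ T

lemma IsClosed.iUnion {ι : Type*} {T : ι → Set D.I} (h : ∀ i, D.IsClosed (T i)) :
    D.IsClosed (⋃ i, T i) := fun j hj => by
  obtain ⟨i, hi⟩ := Set.mem_iUnion.1 hj
  exact (h i j hi).trans (Set.subset_iUnion T i)

variable {D}

lemma IsClosed.union {T U : Set D.I} (hT : D.IsClosed T) (hU : D.IsClosed U) :
    D.IsClosed (T ∪ U) := by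
  rintro j (hj | hj)
  · exact (hT j hj).trans Set.subset_union_left
  · exact (hU j hj).trans Set.subset_union_right

lemma IsClosed.corr_mem {T : Set D.I} (hT : D.IsClosed T) {i : D.I} (hi : i ∈ T)
    {r : D.G →₀ R} (hr : r ∈ D.rel i) : D.corr i r ∈ D.free (T ∩ Set.Iio i) := by
  rw [free_inter]
  exact ⟨fun g hg => hT i hi ⟨g, Set.mem_biUnion hr hg, rfl⟩, (D.corr_spec hr).1⟩

variable (D)

/-- The relations with leading part at level `i`. -/
def fullRel (i : D.I) : Set (D.G →₀ R) := (fun r => r - D.corr i r) '' D.rel i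

lemma span_fullRel_le_ker (T : Set D.I) :
    Submodule.span R (⋃ i ∈ T, D.fullRel i) ≤ LinearMap.ker D.π := by
  rw [Submodule.span_le]
  intro x hx
  obtain ⟨i, -, r, hr, rfl⟩ := Set.mem_iUnion₂.1 hx
  simp [(D.corr_spec hr).2]

variable {D}

lemma rel_subset_free {i : D.I} : D.rel i ⊆ D.free {i} := fun r hr =>
  ((D.mem_span_rel i r).1 (Submodule.subset_span hr)).1

lemma IsClosed.span_fullRel_le_free {T U : Set D.I} (hT : D.IsClosed T) (hU : U ⊆ T) :
    Submodule.span R (⋃ i ∈ U, D.fullRel i) ≤ D.free T := by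
  rw [Submodule.span_le]
  intro x hx
  obtain ⟨i, hi, r, hr, rfl⟩ := Set.mem_iUnion₂.1 hx
  exact sub_mem (D.free_mono (Set.singleton_subset_iff.2 (hU hi)) (rel_subset_free hr))
    (D.free_mono Set.inter_subset_left (hT.corr_mem (hU hi) hr))

/-- Leading parts and full relations differ only by corrections, which closedness keeps inside `T`
and strictly below `i`. This drives the elimination of the top level. -/
lemma IsClosed.exists_fullRel {T : Set D.I} (hT : D.IsClosed T) {i : D.I} (hi : i ∈ T)
    {x : D.G →₀ R} (hx : x ∈ Submodule.span R (D.rel i)) :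
    ∃ z ∈ Submodule.span R (D.fullRel i), x - z ∈ D.free (T ∩ Set.Iio i) := by
  induction hx using Submodule.span_induction with
  | mem r hr =>
    exact ⟨_, Submodule.subset_span ⟨r, hr, rfl⟩, by simpa using hT.corr_mem hi hr⟩
  | zero => exact ⟨0, zero_mem _, by simp⟩
  | add x y _ _ hx hy =>
    obtain ⟨a, ha, ha'⟩ := hx
    obtain ⟨b, hb, hb'⟩ := hy
    exact ⟨a + b, add_mem ha hb, by simpa only [add_sub_add_comm] using add_mem ha' hb'⟩
  | smul c x _ hx =>
    obtain ⟨a, ha, ha'⟩ := hx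
    exact ⟨c • a, Submodule.smul_mem _ c ha, by
      simpa only [smul_sub] using Submodule.smul_mem _ c ha'⟩

lemma IsClosed.exists_rel {T : Set D.I} (hT : D.IsClosed T) {i : D.I} (hi : i ∈ T)
    {z : D.G →₀ R} (hz : z ∈ Submodule.span R (D.fullRel i)) :
    ∃ x ∈ Submodule.span R (D.rel i), x - z ∈ D.free (T ∩ Set.Iio i) := by
  induction hz using Submodule.span_induction with
  | mem r hr =>
    obtain ⟨r, hr, rfl⟩ := hr
    exact ⟨r, Submodule.subset_span hr, by simpa using hT.corr_mem hi hr⟩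
  | zero => exact ⟨0, zero_mem _, by simp⟩
  | add x y _ _ hx hy =>
    obtain ⟨a, ha, ha'⟩ := hx
    obtain ⟨b, hb, hb'⟩ := hy
    exact ⟨a + b, add_mem ha hb, by simpa only [add_sub_add_comm] using add_mem ha' hb'⟩
  | smul c x _ hx =>
    obtain ⟨a, ha, ha'⟩ := hx
    exact ⟨c • a, Submodule.smul_mem _ c ha, by
      simpa only [smul_sub] using Submodule.smul_mem _ c ha'⟩

/-- Transfinite induction on a bound for the levels. The top component of a relation maps into what
lies below, so it is a combination of leading parts; subtracting the corresponding full relations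
leaves a relation inside `T` on strictly lower levels. -/
lemma IsClosed.mem_span_fullRel {T : Set D.I} (hT : D.IsClosed T) {x : D.G →₀ R}
    (hx : x ∈ D.free T) (h0 : D.π x = 0) : x ∈ Submodule.span R (⋃ i ∈ T, D.fullRel i) := by
  have key (i : D.I) : ∀ x ∈ D.free (T ∩ Set.Iic i), D.π x = 0 →
      x ∈ Submodule.span R (⋃ i ∈ T, D.fullRel i) := by
    induction i using WellFoundedLT.induction with
    | ind i ih =>
      intro x hx h0
      have hsplit : T ∩ Set.Iic i = (T ∩ {i}) ∪ (T ∩ Set.Iio i) := by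
        rw [← Set.inter_union_distrib_left, Set.singleton_union, Set.Iio_insert]
      rw [hsplit, free_union] at hx
      obtain ⟨a, ha, b, hb, rfl⟩ := Submodule.mem_sup.1 hx
      have hz : ∃ z ∈ Submodule.span R (⋃ i ∈ T, D.fullRel i), a - z ∈ D.free (T ∩ Set.Iio i) := by
        by_cases hi : i ∈ T
        · have ha' : a ∈ Submodule.span R (D.rel i) := by
            rw [D.mem_span_rel]
            refine ⟨D.free_mono Set.inter_subset_right ha, -b,
              neg_mem (D.free_mono Set.inter_subset_right hb), ?_⟩
            rw [map_neg, neg_eq_iff_add_eq_zero, add_comm, ← map_add, h0]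
          obtain ⟨z, hz, haz⟩ := hT.exists_fullRel hi ha'
          exact ⟨z, Submodule.span_mono (Set.subset_biUnion_of_mem hi) hz, haz⟩
        · rw [Set.inter_singleton_eq_empty.2 hi, free_empty, Submodule.mem_bot] at ha
          exact ⟨0, zero_mem _, by simp [ha]⟩
      obtain ⟨z, hz, haz⟩ := hz
      have hy : a - z + b ∈ Submodule.span R (⋃ i ∈ T, D.fullRel i) := by
        by_cases hy0 : a - z + b = 0
        · rw [hy0]; exact zero_mem _
        -- Finite support provides a highest level `j < i`, even when `i` is a limit point of the
        -- levels.
        obtain ⟨j, hj, hyj⟩ := D.exists_mem_free_Iic (add_mem haz hb) hy0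
        refine ih j hj.2 _ (D.free_mono (Set.inter_subset_inter_left _ Set.inter_subset_left) hyj) ?_
        have hz0 : D.π z = 0 := D.span_fullRel_le_ker T hz
        rw [← h0, map_add, map_sub, map_add, hz0, sub_zero]
      have := add_mem hy hz
      rwa [show a - z + b + z = a + b by abel] at this
  by_cases hx0 : x = 0
  · rw [hx0]; exact zero_mem _
  obtain ⟨j, -, hj⟩ := D.exists_mem_free_Iic hx hx0
  exact key j x hj h0

/-- A relation over `V` splits into relations with leading level in `T` and in `V \ T`; as `T` is
closed, the former stay in `free T`. So modulo `free T` only the relations of `V \ T` matter. -/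
lemma IsClosed.exists_add_of_mem_sub {T V : Set D.I} (hT : D.IsClosed T) (hV : D.IsClosed V)
    (hTV : T ⊆ V) {x : D.G →₀ R} (hx : x ∈ D.free V) (hxT : D.π x ∈ D.sub T) :
    ∃ y ∈ D.free T, ∃ z ∈ Submodule.span R (⋃ i ∈ V \ T, D.fullRel i), x = y + z := by
  obtain ⟨y, hy, hyx⟩ := hxT
  have h := hV.mem_span_fullRel (sub_mem hx (D.free_mono hTV hy)) (by rw [map_sub, hyx, sub_self])
  rw [← Set.union_sdiff_cancel hTV, Set.biUnion_union, Submodule.span_union] at h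
  obtain ⟨a, ha, b, hb, hab⟩ := Submodule.mem_sup.1 h
  exact ⟨y + a, add_mem hy (hT.span_fullRel_le_free subset_rfl ha), b, hb, by
    rw [add_assoc, hab]; abel⟩

end HillSystem

end Hill

/-! ### Quotients of submodules given by closed sets -/

section HillQuotients

variable {R : Type u} [CommRing R]

namespace HillSystem

variable {C : ModuleClass R} {κ : Cardinal.{u}} {M : Type u} [AddCommGroup M] [Module R M]
  {D : HillSystem C κ M} {Q : Type u} [AddCommGroup Q] [Module R Q]

/-- The projection of the free module onto the part with levels in `T`. -/
noncomputable def proj (D : HillSystem C κ M) (T : Set D.I) : (D.G →₀ R) →ₗ[R] D.free T :=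
  haveI := Classical.decPred (· ∈ D.rank ⁻¹' T)
  Finsupp.restrictDom R R (D.rank ⁻¹' T)

lemma proj_of_mem {T : Set D.I} (x : D.free T) : D.proj T x = x := by
  classical
  exact LinearMap.congr_fun (Finsupp.restrictDom_comp_subtype (R := R) (M := R) (D.rank ⁻¹' T)) x

lemma proj_of_disjoint {T U : Set D.I} (h : Disjoint T U) {x : D.G →₀ R} (hx : x ∈ D.free U) :
    D.proj T x = 0 := by
  classical
  refine Subtype.ext (Finsupp.filter_eq_zero_iff _ _ |>.2 fun g hg => ?_)
  by_contra hne
  exact Set.disjoint_left.1 h hg (hx (Finsupp.mem_support_iff.2 hne))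

/-- Here `Q` plays the role of `sub V / sub T`, with `Z` standing in for `sub V`; this lets the base
change of a quotient be used directly. -/
lemma exists_presentation {T V : Set D.I} (hTV : T ⊆ V) {Z : Type u} [AddCommGroup Z] [Module R Z]
    (e : Z →ₗ[R] M) (he : Function.Injective e) (heV : LinearMap.range e = D.sub V)
    (p : Z →ₗ[R] Q) (hp : Function.Surjective p) (hpT : ∀ z, p z = 0 ↔ e z ∈ D.sub T) :
    ∃ q : (D.G →₀ R) →ₗ[R] Q, (∀ x ∈ D.free V, q x = 0 ↔ D.π x ∈ D.sub T) ∧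
      (D.free (V \ T)).map q = ⊤ := by
  have hl : ∀ x : D.free V, ∃ z, e z = D.π x := fun x => by
    have : D.π x ∈ LinearMap.range e := heV ▸ Submodule.mem_map_of_mem x.2
    exact this
  choose l hl using hl
  let l' : D.free V →ₗ[R] Z :=
    { toFun := l
      map_add' := fun x y => he (by simp [hl])
      map_smul' := fun c x => he (by simp [hl]) }
  have hq (x) (hx : x ∈ D.free V) : (p ∘ₗ l' ∘ₗ D.proj V) x = 0 ↔ D.π x ∈ D.sub T := by
    have h1 : D.proj V x = ⟨x, hx⟩ := proj_of_mem ⟨x, hx⟩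
    have h2 : e (l' ⟨x, hx⟩) = D.π x := hl ⟨x, hx⟩
    rw [LinearMap.comp_apply, LinearMap.comp_apply, h1, hpT, h2]
  refine ⟨p ∘ₗ l' ∘ₗ D.proj V, hq, eq_top_iff.2 fun y _ => ?_⟩
  obtain ⟨z, rfl⟩ := hp y
  obtain ⟨x, hx, hxz⟩ : e z ∈ D.sub V := heV ▸ LinearMap.mem_range_self e z
  have hx' := hx
  rw [SetLike.mem_coe, ← Set.union_sdiff_cancel hTV, free_union] at hx'
  obtain ⟨a, ha, b, hb, rfl⟩ := Submodule.mem_sup.1 hx'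
  refine ⟨b, hb, ?_⟩
  have ha0 := (hq a (D.free_mono hTV ha)).2 (Submodule.mem_map_of_mem ha)
  have h1 : D.proj V (a + b) = ⟨a + b, hx⟩ := proj_of_mem ⟨a + b, hx⟩
  have h2 : (p ∘ₗ l' ∘ₗ D.proj V) (a + b) = p z := by
    rw [LinearMap.comp_apply, LinearMap.comp_apply, h1]
    congr 1
    exact he ((hl ⟨a + b, hx⟩).trans hxz)
  rw [← h2, map_add, ha0, zero_add]

/-- The generators are those of `V \ T`, and the relations are the full relations of `V \ T` with
their `T`-coordinates deleted. -/
lemma isLEPresented_of_presentation (hκ : Cardinal.aleph0 ≤ κ) {T V : Set D.I}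
    (hT : D.IsClosed T) (hV : D.IsClosed V) (hTV : T ⊆ V) (hcard : Cardinal.mk ↑(V \ T) ≤ κ)
    (q : (D.G →₀ R) →ₗ[R] Q) (hq : ∀ x ∈ D.free V, q x = 0 ↔ D.π x ∈ D.sub T)
    (hqtop : (D.free (V \ T)).map q = ⊤) : IsLEPresented R κ Q := by
  have hlin : ∀ x ∈ D.free V, x - D.proj (V \ T) x ∈ D.free T := fun x hx => by
    rw [← Set.union_sdiff_cancel hTV, free_union] at hx
    obtain ⟨a, ha, b, hb, rfl⟩ := Submodule.mem_sup.1 hx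
    have h1 : D.proj (V \ T) b = ⟨b, hb⟩ := proj_of_mem ⟨b, hb⟩
    rw [map_add, proj_of_disjoint disjoint_sdiff_self_left ha, h1, zero_add]
    simpa using ha
  have hsub : V \ T ⊆ V := Set.sdiff_subset
  refine isLEPresented_of_surjective (F := D.free (V \ T))
    (Module.Basis.ofRepr (Finsupp.supportedEquivFinsupp _))
    (D.mk_rank_preimage_le hκ hcard) (q ∘ₗ (D.free (V \ T)).subtype) ?_ ?_
  · intro y
    obtain ⟨x, hx, rfl⟩ : y ∈ (D.free (V \ T)).map q := hqtop ▸ Submodule.mem_top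
    exact ⟨⟨x, hx⟩, rfl⟩
  · have hgen : IsLEGenerated κ (Submodule.span R (⋃ i ∈ V \ T, D.fullRel i)) :=
      ⟨_, mk_biUnion_le_of_le hκ _ hcard _ fun i _ => Cardinal.mk_image_le.trans (D.mk_rel i), rfl⟩
    convert! hgen.map (N := D.free (V \ T)) (D.proj (V \ T)) using 1
    ext x
    rw [LinearMap.mem_ker, LinearMap.comp_apply, Submodule.subtype_apply,
      hq x (D.free_mono hsub x.2)]
    constructor
    · intro hx
      obtain ⟨y, hy, z, hz, hxyz⟩ := hT.exists_add_of_mem_sub hV hTV (D.free_mono hsub x.2) hx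
      refine ⟨z, hz, ?_⟩
      have := congrArg (D.proj (V \ T)) hxyz
      rw [proj_of_mem, map_add, proj_of_disjoint disjoint_sdiff_self_left hy, zero_add] at this
      exact this.symm
    · rintro ⟨z, hz, rfl⟩
      have h1 := Submodule.mem_map_of_mem (f := D.π) (hlin z (hV.span_fullRel_le_free hsub hz))
      have h0 : D.π z = 0 := D.span_fullRel_le_ker _ hz
      rw [map_sub, h0, zero_sub] at h1
      exact neg_mem_iff.1 h1

/-- Adding one level to a closed set contributes exactly that level's factor: an element of level
`i` falls into the image of `U` precisely when it is a combination of leading parts at `i`. -/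
lemma factor_of_presentation {T V : Set D.I} (hTV : T ⊆ V)
    (q : (D.G →₀ R) →ₗ[R] Q) (hq : ∀ x ∈ D.free V, q x = 0 ↔ D.π x ∈ D.sub T)
    {U : Set D.I} (hU : D.IsClosed (T ∪ U)) {i : D.I} (hi : i ∉ T ∪ U)
    (hUi : D.IsClosed (T ∪ insert i U)) (hUV : insert i U ⊆ V) :
    C (((D.free (insert i U)).map q : Submodule R Q) ⧸
      ((D.free U).map q).submoduleOf ((D.free (insert i U)).map q)) := by
  have hiU : ({i} : Set D.I) ⊆ insert i U := Set.singleton_subset_iff.2 (Set.mem_insert i U)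
  have hTU : T ∪ insert i U = insert i (T ∪ U) := Set.union_insert
  have hTUV : T ∪ insert i U ⊆ V := Set.union_subset hTV hUV
  have hiT : i ∈ T ∪ insert i U := .inr (Set.mem_insert i U)
  have hIio : (T ∪ insert i U) ∩ Set.Iio i ⊆ T ∪ U := by
    rintro j ⟨hj | rfl | hj, hji⟩
    · exact .inl hj
    · exact absurd hji (lt_irrefl _)
    · exact .inr hj
  let g : D.free {i} →ₗ[R] ((D.free (insert i U)).map q : Submodule R Q) :=
    q.restrict fun x hx => Submodule.mem_map_of_mem (D.free_mono hiU hx)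
  let f := (((D.free U).map q).submoduleOf ((D.free (insert i U)).map q)).mkQ ∘ₗ g ∘ₗ D.proj {i}
  have hf (x) (hx : x ∈ D.free {i}) : f x = Submodule.Quotient.mk (g ⟨x, hx⟩) := by
    have h1 : D.proj {i} x = ⟨x, hx⟩ := proj_of_mem ⟨x, hx⟩
    simp only [f, LinearMap.comp_apply, h1, Submodule.mkQ_apply]
  refine D.factor i _ f (eq_top_iff.2 fun y _ => ?_) fun x hx => ?_
  · obtain ⟨⟨_, v, hv, rfl⟩, rfl⟩ := Submodule.Quotient.mk_surjective _ y
    have hv' := hv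
    rw [SetLike.mem_coe, Set.insert_eq, free_union] at hv'
    obtain ⟨a, ha, b, hb, rfl⟩ := Submodule.mem_sup.1 hv'
    refine ⟨a, ha, ?_⟩
    rw [hf a ha, Submodule.Quotient.eq]
    change q a - q (a + b) ∈ (D.free U).map q
    rw [← map_sub, sub_add_cancel_left]
    exact Submodule.mem_map_of_mem (neg_mem hb)
  · rw [hf x hx, Submodule.Quotient.mk_eq_zero]
    change q x ∈ (D.free U).map q ↔ _
    have hxV : x ∈ D.free V := D.free_mono (hiU.trans hUV) hx
    constructor
    · rintro ⟨w, hw, hwx⟩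
      have hwV : w ∈ D.free V := D.free_mono ((Set.subset_insert _ _).trans hUV) hw
      have h1 := (hq (x - w) (sub_mem hxV hwV)).1 (by rw [map_sub, hwx, sub_self])
      have h2 : D.π x ∈ D.sub (T ∪ U) := by
        have := add_mem (D.sub_mono Set.subset_union_left h1)
          (D.sub_mono Set.subset_union_right (Submodule.mem_map_of_mem hw))
        rwa [map_sub, sub_add_cancel] at this
      obtain ⟨y, hy, z, hz, hxyz⟩ := hU.exists_add_of_mem_sub hUi
        (Set.union_subset_union_right _ (Set.subset_insert _ _))
        (D.free_mono (Set.singleton_subset_iff.2 hiT) hx) h2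
      have hdiff : (T ∪ insert i U) \ (T ∪ U) = {i} := by
        rw [hTU]
        ext j
        refine ⟨fun h => h.1.resolve_right h.2, ?_⟩
        rintro rfl
        exact ⟨Set.mem_insert _ _, hi⟩
      rw [hdiff, Set.biUnion_singleton] at hz
      obtain ⟨r, hr, hrz⟩ := hUi.exists_rel hiT hz
      have h3 : x - r ∈ D.free (T ∪ U) := by
        have := sub_mem hy (D.free_mono hIio hrz)
        rwa [show y - (r - z) = x - r by rw [hxyz]; abel] at this
      have h4 : x - r ∈ D.free {i} := sub_mem hx ((D.mem_span_rel i r).1 hr).1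
      -- The difference is supported both at level `i` and away from it, hence vanishes.
      have h5 : x - r ∈ D.free ({i} ∩ (T ∪ U)) := by rw [free_inter]; exact ⟨h4, h3⟩
      rw [Set.singleton_inter_eq_empty.2 hi, free_empty, Submodule.mem_bot, sub_eq_zero] at h5
      rwa [h5]
    · intro hxr
      obtain ⟨z, hz, hxz⟩ := hUi.exists_fullRel hiT hxr
      have hz' : z ∈ Submodule.span R (⋃ j ∈ ({i} : Set D.I), D.fullRel j) := by
        rwa [Set.biUnion_singleton]
      have hqz : q z = 0 := by
        rw [hq z (D.free_mono hTUV (hUi.span_fullRel_le_free (Set.singleton_subset_iff.2 hiT) hz')),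
          show D.π z = 0 from D.span_fullRel_le_ker _ hz']
        exact zero_mem _
      have h1 := D.free_mono hIio hxz
      rw [free_union] at h1
      obtain ⟨a, ha, b, hb, hab⟩ := Submodule.mem_sup.1 h1
      have hqa := (hq a (D.free_mono hTV ha)).2 (Submodule.mem_map_of_mem ha)
      refine ⟨b, hb, ?_⟩
      have := congrArg q hab
      rwa [map_add, map_sub, hqa, hqz, zero_add, sub_zero] at this

lemma filtered_of_presentation {T V : Set D.I}
    (hT : D.IsClosed T) (hV : D.IsClosed V) (hTV : T ⊆ V)
    (q : (D.G →₀ R) →ₗ[R] Q) (hq : ∀ x ∈ D.free V, q x = 0 ↔ D.π x ∈ D.sub T)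
    (hqtop : (D.free (V \ T)).map q = ⊤) : Filtered C Q := by
  refine filtered_of_exists_lt C (X := Set D.I) (fun U => (D.free U).map q)
    (fun _ _ h => Submodule.map_mono (D.free_mono h))
    (fun x => by simp only [Set.iSup_eq_iUnion, free_iUnion, Submodule.map_iSup])
    {U | U ⊆ V \ T ∧ D.IsClosed (T ∪ U)} ?_ ?_
  · intro s hs
    refine ⟨Set.sUnion_subset fun U hU => (hs hU).1, ?_⟩
    rintro j (hj | ⟨U, hU, hj⟩)
    · exact (hT j hj).trans Set.subset_union_left
    · exact ((hs hU).2 j (.inr hj)).trans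
        (Set.union_subset_union_right _ (Set.subset_sUnion_of_mem hU))
  · rintro U ⟨hU, hTU⟩ hne
    have hnon : ((V \ T) \ U).Nonempty := by
      rw [Set.nonempty_iff_ne_empty, Ne, Set.sdiff_eq_empty]
      intro h
      exact hne (by rw [subset_antisymm hU h, hqtop])
    obtain ⟨i, ⟨⟨hiV, hiT⟩, hiU⟩, hmin⟩ := WellFounded.has_min
      (wellFounded_lt (α := D.I)) _ hnon
    -- Minimality of `i` preserves closedness: its dependencies are smaller levels of `V`, so none
    -- of them is still missing.
    have hUi : insert i U ⊆ V \ T := Set.insert_subset ⟨hiV, hiT⟩ hU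
    have hclosed : D.IsClosed (T ∪ insert i U) := by
      rw [Set.union_insert]
      rintro j (rfl | hj)
      · intro k hk
        by_contra hk'
        simp only [Set.mem_insert_iff, Set.mem_union, not_or] at hk'
        exact hmin k ⟨⟨hV j hiV hk, hk'.2.1⟩, hk'.2.2⟩ (D.deps_subset_Iio j hk)
      · exact (hTU j hj).trans (Set.subset_insert _ _)
    refine ⟨insert i U, ⟨hUi, hclosed⟩, Set.ssubset_insert hiU, _, _, _,
      factor_of_presentation hTV q hq hTU ?_ hclosed (hUi.trans Set.sdiff_subset),
      ⟨LinearEquiv.refl R _⟩⟩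
    rintro (h | h)
    exacts [hiT h, hiU h]

end HillSystem

end HillQuotients

/-! ### From a filtration to a stratified presentation -/

section FiltrationToHill

variable {R : Type u} [CommRing R]

/-- A filtration of length one shows that such a class is invariant under isomorphism. -/
lemma ClosedUnderTransfiniteExtensions.of_linearEquiv {C : ModuleClass R}
    (hC : ClosedUnderTransfiniteExtensions C) {M N : Type u} [AddCommGroup M] [Module R M]
    [AddCommGroup N] [Module R N] (hN : C N) (e : M ≃ₗ[R] N) : C M := by
  refine hC M ⟨1, fun a => if a = 0 then ⊥ else ⊤, ?_, ?_, ?_, ?_, ?_⟩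
  · simp
  · simp
  · intro a b hab _
    by_cases ha : a = 0
    · simp [ha]
    · have hb : b ≠ 0 := fun h => ha (nonpos_iff_eq_zero.1 (hab.trans_eq h))
      simp [ha, hb]
  · intro a ha hlim
    exact absurd ha (not_le.2 (Ordinal.one_lt_of_isSuccLimit hlim))
  · intro a ha
    obtain rfl := Order.lt_one_iff.1 ha
    have key : ∀ A B : Submodule R M, A = ⊥ → B = ⊤ →
        Nonempty ((B ⧸ A.submoduleOf B) ≃ₗ[R] N) := by
      rintro _ _ rfl rfl
      exact ⟨Submodule.quotEquivOfEqBot _ (by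
        rw [Submodule.submoduleOf, Submodule.comap_bot, Submodule.ker_subtype]) ≪≫ₗ
          Submodule.topEquiv ≪≫ₗ e⟩
    exact ⟨N, _, _, hN, key _ _ (if_pos rfl) (if_neg (Order.succ_ne_bot 0))⟩

lemma exists_hillSystem {P : ModuleClass R} (hP : ClosedUnderTransfiniteExtensions P)
    {κ : Cardinal.{u}} {M : Type u} [AddCommGroup M] [Module R M]
    (hM : Filtered (LEPresentedIn P κ) M) : Nonempty (HillSystem P κ M) := by
  obtain ⟨σ, F, hF⟩ := hM
  let o : σ.ToType → Ordinal.{u} := fun i => (Ordinal.ToType.mk.symm i).1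
  have ho (i) : o i < σ := (Ordinal.ToType.mk.symm i).2
  have hoi : ∀ {i j}, o i < o j ↔ i < j := fun {i j} => Ordinal.ToType.mk.symm.lt_iff_lt
  have hosurj : ∀ a < σ, ∃ i, o i = a := fun a ha =>
    ⟨Ordinal.ToType.mk ⟨a, ha⟩, by simp [o]⟩
  have hfac (i : σ.ToType) :
      P (F (Order.succ (o i)) ⧸ (F (o i)).submoduleOf (F (Order.succ (o i)))) ∧
      IsLEPresented R κ (F (Order.succ (o i)) ⧸ (F (o i)).submoduleOf (F (Order.succ (o i)))) := by
    obtain ⟨N, _, _, hN, ⟨e⟩⟩ := hF.factor (o i) (ho i)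
    exact ⟨ClosedUnderTransfiniteExtensions.of_linearEquiv hP hN.1 e, hN.2.of_linearEquiv e.symm⟩
  choose G f hG hf s hs hsf using fun i => exists_ker_eq_span_of_isLEPresented (hfac i).2
  have hlift (i) (g : G i) : ∃ a : F (Order.succ (o i)),
      Submodule.Quotient.mk a = f i (Finsupp.single g 1) := Submodule.Quotient.mk_surjective _ _
  choose a ha using hlift
  let π : ((Σ i, G i) →₀ R) →ₗ[R] M := Finsupp.linearCombination R fun g => (a g.1 g.2 : M)
  let E : ∀ i, (G i →₀ R) →ₗ[R] ((Σ i, G i) →₀ R) := fun i => Finsupp.lmapDomain R R (Sigma.mk i)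
  let l : ∀ i, (G i →₀ R) →ₗ[R] F (Order.succ (o i)) := fun i => Finsupp.linearCombination R (a i)
  have hl (i) (w : G i →₀ R) : π (E i w) = l i w := by
    have : π ∘ₗ E i = (F (Order.succ (o i))).subtype ∘ₗ l i := by
      ext g
      simp [π, E, l]
    exact LinearMap.congr_fun this w
  have hlf (i) (w : G i →₀ R) : Submodule.Quotient.mk (l i w) = f i w := by
    have : ((F (o i)).submoduleOf (F (Order.succ (o i)))).mkQ ∘ₗ l i = f i := by
      ext g
      simp [l, ha]
    exact LinearMap.congr_fun this w
  have hker (i) (w : G i →₀ R) : f i w = 0 ↔ π (E i w) ∈ F (o i) := by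
    rw [← hlf, Submodule.Quotient.mk_eq_zero, hl]
    rfl
  have hEfree (i) : Finsupp.supported R R (Sigma.fst ⁻¹' {i}) = LinearMap.range (E i) := by
    rw [← Submodule.map_top, ← Finsupp.supported_univ, Finsupp.lmapDomain_supported,
      Set.image_univ, Set.range_sigmaMk]
  -- Lifted generators of the factors below `b` generate `F b`; this identifies the algebraic levels
  -- with the given filtration.
  have hπF : ∀ b ≤ σ, (Finsupp.supported R R (Sigma.fst ⁻¹' {i | o i < b})).map π = F b := by
    intro b hb
    refine le_antisymm ?_ ?_
    · rw [Finsupp.supported_eq_span_single, Submodule.map_span, Submodule.span_le]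
      rintro _ ⟨_, ⟨g, hg, rfl⟩, rfl⟩
      have : π (Finsupp.single g 1) = a g.1 g.2 := by simp [π]
      rw [this]
      exact hF.mono _ _ (Order.succ_le_of_lt hg) hb (a g.1 g.2).2
    · induction b using Ordinal.limitRecOn with
      | zero => rw [hF.zero]; exact bot_le
      | add_one b ih =>
        rw [← Order.succ_eq_add_one] at hb ⊢
        intro x hx
        have hbσ : b < σ := (Order.lt_succ b).trans_le hb
        obtain ⟨i, rfl⟩ := hosurj b hbσ
        obtain ⟨w, hw⟩ := hf i (Submodule.Quotient.mk ⟨x, hx⟩)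
        rw [← hlf, Submodule.Quotient.eq] at hw
        have hw' : π (E i w) - x ∈ F (o i) := by rw [hl]; exact hw
        have h1 := ih hbσ.le hw'
        have h2 : E i w ∈ Finsupp.supported R R (Sigma.fst ⁻¹' {j | o j < Order.succ (o i)}) := by
          have : E i w ∈ Finsupp.supported R R (Sigma.fst ⁻¹' {i}) :=
            hEfree i ▸ LinearMap.mem_range_self _ _
          refine Finsupp.supported_mono (Set.preimage_mono ?_) this
          exact Set.singleton_subset_iff.2 (Order.lt_succ (o i))
        have h3 := Submodule.map_mono (Finsupp.supported_mono (M := R) (R := R)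
          (Set.preimage_mono (f := Sigma.fst (β := G))
            fun j (hj : o j < o i) => hj.trans (Order.lt_succ (o i)))) h1
        have := sub_mem (Submodule.mem_map_of_mem (f := π) h2) h3
        rwa [sub_sub_cancel] at this
      | limit b hlim ih =>
        intro x hx
        have hx' : x ∈ (F b : Set M) := hx
        rw [hF.limit b hb hlim] at hx'
        obtain ⟨⟨c, hc⟩, hxc⟩ := Set.mem_iUnion.1 hx'
        exact Submodule.map_mono (Finsupp.supported_mono (Set.preimage_mono
          fun j (hj : o j < c) => hj.trans hc)) (ih c hc (hc.le.trans hb) hxc)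
  have hmem (i) (x : (Σ i, G i) →₀ R) : x ∈ Submodule.span R (E i '' s i) ↔
      x ∈ Finsupp.supported R R (Sigma.fst ⁻¹' {i}) ∧ π x ∈ F (o i) := by
    rw [← Submodule.map_span, hsf, hEfree]
    constructor
    · rintro ⟨w, hw, rfl⟩
      exact ⟨⟨w, rfl⟩, (hker i w).1 hw⟩
    · rintro ⟨⟨w, rfl⟩, hw⟩
      exact ⟨w, (hker i w).2 hw, rfl⟩
  refine ⟨⟨σ.ToType, Σ i, G i, Sigma.fst, π, fun i => E i '' s i, fun i => ?_,
    fun i => Cardinal.mk_image_le.trans (hs i), ?_, fun i x => ?_, fun i Q _ _ q hq hqk => ?_⟩⟩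
  · rw [← Set.range_sigmaMk]
    exact Cardinal.mk_range_le.trans (hG i)
  · rw [← LinearMap.range_eq_top, ← hF.top, ← hπF σ le_rfl, ← Submodule.map_top,
      ← Finsupp.supported_univ]
    congr 2
    ext g
    simp [ho]
  · rw [hmem, ← hπF (o i) (ho i).le]
    simp only [hoi]
    rfl
  · have hqs : Function.Surjective (q ∘ₗ E i) := by
      rw [← LinearMap.range_eq_top, LinearMap.range_comp, ← hEfree, hq]
    obtain ⟨e⟩ := nonempty_linearEquiv_of_ker_eq (q ∘ₗ E i) (f i) hqs (hf i) (by
      ext w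
      have hw : E i w ∈ Finsupp.supported R R (Sigma.fst ⁻¹' {i}) :=
        hEfree i ▸ LinearMap.mem_range_self _ _
      rw [LinearMap.mem_ker, LinearMap.mem_ker, LinearMap.comp_apply, hqk _ hw, hmem, hker]
      exact and_iff_right hw)
    exact ClosedUnderTransfiniteExtensions.of_linearEquiv hP (hfac i).1 e

end FiltrationToHill

/-! ### Base change of submodules, presentations and filtrations -/

section BaseChange

variable {R S : Type u} [CommRing R] [CommRing S] [Algebra R S] {M N : Type u} [AddCommGroup M]
  [Module R M] [AddCommGroup N] [Module R N] {κ : Cardinal.{u}}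

lemma baseChange_le_iff_forall {A : Submodule R M} {B : Submodule S (S ⊗[R] M)} :
    A.baseChange S ≤ B ↔ ∀ m ∈ A, (1 : S) ⊗ₜ[R] m ∈ B := by
  rw [Submodule.baseChange_eq_span, Submodule.span_le]
  constructor
  · exact fun h m hm => h ⟨m, hm, rfl⟩
  · rintro h _ ⟨m, hm, rfl⟩
    exact h m hm

lemma baseChange_map (f : M →ₗ[R] N) (A : Submodule R M) :
    (A.map f).baseChange S = (A.baseChange S).map (f.baseChange S) := by
  apply le_antisymm
  · rw [baseChange_le_iff_forall]
    rintro _ ⟨m, hm, rfl⟩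
    exact ⟨1 ⊗ₜ m, Submodule.tmul_mem_baseChange_of_mem _ hm, by simp⟩
  · rw [Submodule.map_le_iff_le_comap, baseChange_le_iff_forall]
    intro m hm
    rw [Submodule.mem_comap, LinearMap.baseChange_tmul]
    exact Submodule.tmul_mem_baseChange_of_mem _ (Submodule.mem_map_of_mem hm)

lemma baseChange_iSup {ι : Sort*} (A : ι → Submodule R M) :
    (⨆ i, A i).baseChange S = ⨆ i, (A i).baseChange S := by
  refine le_antisymm ?_ (iSup_le fun i => Submodule.baseChange_mono S (le_iSup A i))
  rw [baseChange_le_iff_forall]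
  have : ⨆ i, A i ≤ ((⨆ i, (A i).baseChange S).restrictScalars R).comap
      (TensorProduct.mk R S M 1) := iSup_le fun i m hm =>
    Submodule.mem_iSup_of_mem (p := fun i => (A i).baseChange S) i
      (Submodule.tmul_mem_baseChange_of_mem _ hm)
  exact fun m hm => this hm

lemma baseChange_sup (A B : Submodule R M) :
    (A ⊔ B).baseChange S = A.baseChange S ⊔ B.baseChange S := by
  rw [sup_eq_iSup, baseChange_iSup, sup_eq_iSup]
  congr 1
  ext b : 1
  cases b <;> rfl

lemma ker_baseChange (f : M →ₗ[R] N) (hf : Function.Surjective f) :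
    LinearMap.ker (f.baseChange S) = (LinearMap.ker f).baseChange S := by
  ext x
  exact lTensor_exact S f.exact_subtype_ker_map hf x

lemma subtype_baseChange_injective [Module.Flat R S] (A : Submodule R M) :
    Function.Injective (A.subtype.baseChange S) :=
  Module.Flat.lTensor_preserves_injective_linearMap (M := S) A.subtype A.injective_subtype

lemma subtype_baseChange_mem_iff [Module.Flat R S] {A B : Submodule R M} (h : A ≤ B)
    (x : S ⊗[R] B) :
    B.subtype.baseChange S x ∈ A.baseChange S ↔ x ∈ (A.submoduleOf B).baseChange S := by
  have : A = (A.submoduleOf B).map B.subtype := by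
    rw [Submodule.submoduleOf, Submodule.map_comap_subtype, inf_eq_right.2 h]
  conv_lhs => rw [this, baseChange_map]
  exact (subtype_baseChange_injective B).mem_set_image

lemma IsLEPresented.baseChange (h : IsLEPresented R κ M) : IsLEPresented S κ (S ⊗[R] M) := by
  obtain ⟨G, f, hG, hf, s, hs, hsf⟩ := exists_ker_eq_span_of_isLEPresented h
  refine isLEPresented_of_surjective (Finsupp.basisSingleOne.baseChange S) hG (f.baseChange S)
    (LinearMap.lTensor_surjective S hf) ?_
  rw [ker_baseChange f hf, ← hsf, Submodule.baseChange_span]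
  exact ⟨_, Cardinal.mk_image_le.trans hs, rfl⟩

/-- Over `S` the relations are generated by at most `κ` elements, each using finitely many `1 ⊗ k`
with `k` a relation over `R`. These `k` generate all relations after base change, hence already over
`R` by faithful flatness. -/
lemma IsLEPresented.of_baseChange [Module.FaithfullyFlat R S] (hκ : Cardinal.aleph0 ≤ κ)
    (hM : IsLEGenerated κ (⊤ : Submodule R M)) (h : IsLEPresented S κ (S ⊗[R] M)) :
    IsLEPresented R κ M := by
  obtain ⟨s, hs, hsM⟩ := hM
  let f : (s →₀ R) →ₗ[R] M := Finsupp.linearCombination R Subtype.val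
  have hf : Function.Surjective f := by
    rw [← LinearMap.range_eq_top, Finsupp.range_linearCombination, Subtype.range_coe, hsM]
  let b : Module.Basis s S (S ⊗[R] (s →₀ R)) := Finsupp.basisSingleOne.baseChange S
  obtain ⟨Z, hZ, hZf⟩ := isLEGenerated_ker_of_isLEPresented hκ h
    ⟨Set.range b, Cardinal.mk_range_le.trans hs, b.span_eq⟩ (f.baseChange S)
    (LinearMap.lTensor_surjective S hf)
  rw [ker_baseChange f hf] at hZf
  obtain ⟨B, hB, hBκ, hZB⟩ := exists_subset_of_subset_span (R := S) hκ
    (TensorProduct.mk R S (s →₀ R) 1) (LinearMap.ker f : Set (s →₀ R)) hZ (by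
      rw [← Submodule.baseChange_span, Submodule.span_eq, ← hZf]
      exact Submodule.subset_span)
  refine isLEPresented_of_surjective Finsupp.basisSingleOne hs f hf ⟨B, hBκ, le_antisymm ?_ ?_⟩
  · exact Submodule.span_le.2 hB
  · rw [← Submodule.baseChange_le_iff (A := S), ← hZf, Submodule.baseChange_span]
    exact Submodule.span_le.2 hZB

lemma nonempty_quotient_equiv_baseChange {A B : Submodule R M} (e : (B ⧸ A.submoduleOf B) ≃ₗ[R] N)
    {L : Type u} [AddCommGroup L] [Module S L] {A' B' : Submodule S L} (f : S ⊗[R] B →ₗ[S] B')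
    (hf : Function.Surjective f)
    (hfA : ∀ x, (f x : L) ∈ A' ↔ x ∈ (A.submoduleOf B).baseChange S) :
    Nonempty ((B' ⧸ A'.submoduleOf B') ≃ₗ[S] S ⊗[R] N) := by
  let g : B →ₗ[R] N := e.toLinearMap ∘ₗ (A.submoduleOf B).mkQ
  have hg : Function.Surjective g := e.surjective.comp (Submodule.mkQ_surjective _)
  have hgk : LinearMap.ker g = A.submoduleOf B := by
    rw [LinearEquiv.ker_comp, Submodule.ker_mkQ]
  refine nonempty_linearEquiv_of_ker_eq ((A'.submoduleOf B').mkQ ∘ₗ f) (g.baseChange S)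
    ((Submodule.mkQ_surjective _).comp hf) (LinearMap.lTensor_surjective S hg) ?_
  ext x
  rw [ker_baseChange g hg, hgk, ← hfA, LinearMap.ker_comp, Submodule.ker_mkQ]
  rfl

lemma IsFiltration.baseChange [Module.Flat R S] {C : ModuleClass R} {C' : ModuleClass S}
    (hC : ∀ (N : Type u) [AddCommGroup N] [Module R N], C N → C' (S ⊗[R] N))
    {σ : Ordinal.{u}} {F : Ordinal.{u} → Submodule R M} (hF : IsFiltration C M σ F) :
    IsFiltration C' (S ⊗[R] M) σ fun a => (F a).baseChange S where
  zero := by rw [hF.zero, Submodule.baseChange_bot]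
  top := by rw [hF.top, Submodule.baseChange_top]
  mono a b hab hb := Submodule.baseChange_mono S (hF.mono a b hab hb)
  limit a ha hlim := by
    have hne : Nonempty (Set.Iio a) := ⟨⟨0, hlim.bot_lt⟩⟩
    have hmono : Monotone fun b : Set.Iio a => F b := fun b c hbc =>
      hF.mono _ _ hbc (c.2.le.trans ha)
    have hsup : F a = ⨆ b : Set.Iio a, F b := by
      apply SetLike.coe_injective
      rw [Submodule.coe_iSup_of_directed _ hmono.directed_le]
      exact hF.limit a ha hlim
    have hmono' : Monotone fun b : Set.Iio a => (F b).baseChange S := fun b c hbc =>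
      Submodule.baseChange_mono S (hmono hbc)
    rw [hsup, baseChange_iSup, Submodule.coe_iSup_of_directed _ hmono'.directed_le]
  factor a ha := by
    obtain ⟨N, _, _, hN, ⟨e⟩⟩ := hF.factor a ha
    exact ⟨S ⊗[R] N, _, _, hC N hN, nonempty_quotient_equiv_baseChange e
      ((F (Order.succ a)).toBaseChange S) ((F (Order.succ a)).toBaseChange_surjective S)
      (subtype_baseChange_mem_iff (hF.mono _ _ (Order.le_succ a) (Order.succ_le_of_lt ha)))⟩

lemma HillSystem.exists_closed_baseChange_span {C : ModuleClass S} (hκ : Cardinal.aleph0 ≤ κ)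
    (D : HillSystem C κ (S ⊗[R] M)) (x : M) :
    ∃ (B : Set M) (U : Set D.I), x ∈ B ∧ Cardinal.mk B ≤ κ ∧ Cardinal.mk U ≤ κ ∧ D.IsClosed U ∧
      (Submodule.span R B).baseChange S = D.sub U := by
  have hgen (m : M) : ∃ T : Set D.I, Cardinal.mk T ≤ κ ∧ (1 : S) ⊗ₜ[R] m ∈ D.sub T := by
    obtain ⟨B, -, hB, hm⟩ := exists_subset_of_subset_span (R := S) hκ
      (fun g => D.π (Finsupp.single g 1)) (D.rank ⁻¹' Set.univ) (Z := {(1 : S) ⊗ₜ[R] m})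
      (by rw [Cardinal.mk_singleton]; exact Cardinal.one_le_aleph0.trans hκ)
      (by rw [← D.sub_eq_span, D.sub_univ]; exact Set.subset_univ _)
    refine ⟨D.rank '' B, Cardinal.mk_image_le.trans hB, ?_⟩
    rw [D.sub_eq_span]
    exact Submodule.span_mono (Set.image_mono (Set.subset_preimage_image _ _))
      (Set.singleton_subset_iff.1 hm)
  have hlev (i : D.I) : ∃ B : Set M, Cardinal.mk B ≤ κ ∧
      D.sub {i} ≤ (Submodule.span R B).baseChange S := by
    obtain ⟨B, -, hB, hm⟩ := exists_subset_of_subset_span (R := S) hκ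
      (TensorProduct.mk R S M 1) Set.univ
      (Z := (fun g => D.π (Finsupp.single g 1)) '' (D.rank ⁻¹' {i}))
      (Cardinal.mk_image_le.trans (D.mk_gen i))
      (by rw [← Submodule.baseChange_span, Submodule.span_univ, Submodule.baseChange_top]
          exact Set.subset_univ _)
    refine ⟨B, hB, ?_⟩
    rw [D.sub_eq_span, Submodule.span_le, Submodule.baseChange_span]
    exact hm
  choose t ht htm using hgen
  choose c hc hcm using hlev
  -- The back-and-forth runs in one closure on `M ⊕ D.I`: an element calls for levels generating it,
  -- a level for elements whose base change contains its generators, and also for its dependencies.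
  obtain ⟨Y, hxY, hY, hYc⟩ := exists_closed_of_mk_le (X := M ⊕ D.I) hκ
    (Sum.elim (fun m => Sum.inr '' t m) (fun i => Sum.inl '' c i ∪ Sum.inr '' D.deps i))
    (by
      rintro (m | i)
      · exact Cardinal.mk_image_le.trans (ht m)
      · refine (Cardinal.mk_union_le _ _).trans ((add_le_add (Cardinal.mk_image_le.trans (hc i))
          (Cardinal.mk_image_le.trans (D.mk_deps_le hκ i))).trans ?_)
        rw [Cardinal.add_eq_self hκ])
    (Sum.inl x)
  refine ⟨Sum.inl ⁻¹' Y, Sum.inr ⁻¹' Y, hxY,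
    (Cardinal.mk_preimage_of_injective _ _ Sum.inl_injective).trans hY,
    (Cardinal.mk_preimage_of_injective _ _ Sum.inr_injective).trans hY,
    fun i hi j hj => hYc _ hi (.inr ⟨j, hj, rfl⟩), le_antisymm ?_ ?_⟩
  · rw [Submodule.baseChange_span, Submodule.span_le]
    rintro _ ⟨m, hm, rfl⟩
    exact D.sub_mono (fun i hi => hYc _ hm ⟨i, hi, rfl⟩) (htm m)
  · rw [← Set.biUnion_of_singleton (Sum.inr ⁻¹' Y), Set.biUnion_eq_iUnion, D.sub_iUnion]
    exact iSup_le fun i => (hcm i).trans (Submodule.baseChange_mono S (Submodule.span_mono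
      fun m hm => hYc _ i.2 (.inl ⟨m, hm, rfl⟩)))

end BaseChange

/-! ### Ascent and descent of the restricted property -/

lemma ascends_restrict {𝓡 : RingClass.{u}} {P : ModuleProperty.{u}} (hP : Ascends 𝓡 P)
    (κ : Cardinal.{u}) : Ascends 𝓡 (restrict P κ) := by
  rintro R S _ _ _ hR hS hflat M _ _ ⟨σ, F, hF⟩
  exact ⟨σ, _, hF.baseChange fun N _ _ hN => ⟨hP R S hR hS hflat N hN.1, hN.2.baseChange⟩⟩

lemma isLEGenerated_quotient_sup_span {R M : Type u} [CommRing R] [AddCommGroup M] [Module R M]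
    {κ : Cardinal.{u}} (N : Submodule R M) {B : Set M} (hB : Cardinal.mk B ≤ κ) :
    IsLEGenerated κ (⊤ : Submodule R (↥(N ⊔ Submodule.span R B) ⧸
      N.submoduleOf (N ⊔ Submodule.span R B))) := by
  have h : IsLEGenerated κ (⊤ : Submodule R (Submodule.span R B)) :=
    ⟨Subtype.val ⁻¹' B, (Cardinal.mk_preimage_of_injective _ _ Subtype.val_injective).trans hB,
      Submodule.span_span_coe_preimage⟩
  convert h.map ((N.submoduleOf (N ⊔ Submodule.span R B)).mkQ ∘ₗ
    Submodule.inclusion le_sup_right) using 1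
  refine (eq_top_iff.2 fun y _ => ?_).symm
  obtain ⟨⟨y, hy⟩, rfl⟩ := Submodule.Quotient.mk_surjective _ y
  obtain ⟨n, hn, b, hb, rfl⟩ := Submodule.mem_sup.1 hy
  refine ⟨⟨b, hb⟩, Submodule.mem_top, (Submodule.Quotient.eq _).2 ?_⟩
  change b - (n + b) ∈ N
  simpa using hn

lemma descends_restrict {𝓡 : RingClass.{u}} {P : ModuleProperty.{u}} (hP : Descends 𝓡 P)
    (htrans : ∀ (R : Type u) [CommRing R], 𝓡 R → ClosedUnderTransfiniteExtensions (P R))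
    {κ : Cardinal.{u}} (hκ : Cardinal.aleph0 ≤ κ) : Descends 𝓡 (restrict P κ) := by
  intro R S _ _ _ hR hS hflat M _ _ hM
  obtain ⟨D⟩ := exists_hillSystem (htrans S hS) hM
  refine filtered_of_exists_lt _ (X := Submodule R M) id monotone_id (fun _ => rfl)
    {N | ∃ T, D.IsClosed T ∧ N.baseChange S = D.sub T} ?_ ?_
  · intro s hs
    have hs' : ∀ N ∈ s, ∃ T, D.IsClosed T ∧ N.baseChange S = D.sub T := fun N h => hs h
    choose! T hT hTs using hs'
    refine ⟨⋃ N : s, T N, HillSystem.IsClosed.iUnion D fun N => hT N.1 N.2, ?_⟩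
    rw [sSup_eq_iSup', baseChange_iSup, D.sub_iUnion]
    exact iSup_congr fun N => hTs N.1 N.2
  · rintro N ⟨T, hT, hNT⟩ hN
    obtain ⟨x, -, hx⟩ := SetLike.exists_of_lt (lt_top_iff_ne_top.2 hN)
    obtain ⟨B, U, hxB, hB, hU, hUc, hBU⟩ := D.exists_closed_baseChange_span hκ x
    have hV := hT.union hUc
    have hNV : (N ⊔ Submodule.span R B).baseChange S = D.sub (T ∪ U) := by
      rw [baseChange_sup, hNT, hBU, HillSystem.sub, HillSystem.sub, HillSystem.sub, D.free_union,
        Submodule.map_sup]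
    refine ⟨N ⊔ Submodule.span R B, ⟨T ∪ U, hV, hNV⟩, ?_, _, _, _, ?_, ⟨LinearEquiv.refl R _⟩⟩
    · exact lt_of_le_of_ne le_sup_left fun h => hx
        (h ▸ Submodule.mem_sup_right (Submodule.subset_span hxB))
    · have hmk := Submodule.mkQ_surjective (N.submoduleOf (N ⊔ Submodule.span R B))
      obtain ⟨q, hq, hqtop⟩ := HillSystem.exists_presentation (D := D) (T := T) (V := T ∪ U)
        Set.subset_union_left ((N ⊔ Submodule.span R B).subtype.baseChange S)
        (subtype_baseChange_injective _) hNV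
        ((N.submoduleOf (N ⊔ Submodule.span R B)).mkQ.baseChange S)
        (LinearMap.lTensor_surjective S hmk) fun z => by
          rw [← LinearMap.mem_ker, ker_baseChange _ hmk, Submodule.ker_mkQ, ← hNT,
            subtype_baseChange_mem_iff le_sup_left]
      -- Membership is proved for the base change, where the factor is filtered by members of `P S`,
      -- and then descended.
      refine ⟨hP R S hR hS hflat _ (htrans S hS _ (HillSystem.filtered_of_presentation hT hV
        Set.subset_union_left q hq hqtop)), ?_⟩
      refine IsLEPresented.of_baseChange (S := S) hκ (isLEGenerated_quotient_sup_span N hB) ?_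
      refine HillSystem.isLEPresented_of_presentation hκ hT hV Set.subset_union_left ?_ q hq hqtop
      refine (Cardinal.mk_le_mk_of_subset ?_).trans hU
      rw [Set.union_sdiff_left]
      exact Set.sdiff_subset

end ADProp

theorem theorem4p2 (𝓡 : ADProp.RingClass.{u}) (P : ADProp.ModuleProperty.{u})
    (hAD : ADProp.IsADProperty 𝓡 P)
    (hpure : ∀ (R : Type u) [CommRing R], 𝓡 R → ADProp.ClosedUnderPureSubmodules (P R))
    (htrans : ∀ (R : Type u) [CommRing R], 𝓡 R → ADProp.ClosedUnderTransfiniteExtensions (P R))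
    (hself : ∀ (R : Type u) [CommRing R], 𝓡 R → P R R)
    (κ : Cardinal.{u}) (hκ : Cardinal.aleph0 ≤ κ)
    (hsub : ∀ (R : Type u) [CommRing R], 𝓡 R →
      ∀ (M : Type u) [AddCommGroup M] [Module R M], P R M →
        ∀ A : Set M, Cardinal.mk A ≤ κ →
          ∃ N : Submodule R M, A ⊆ N ∧ ADProp.IsPureSubmodule N ∧ ADProp.IsLEPresented R κ N) :
    ADProp.IsADProperty 𝓡 (ADProp.restrict P κ) :=
  ⟨ADProp.ascends_restrict hAD.1 κ, ADProp.descends_restrict hAD.2 htrans hκ⟩
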